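/- Let $k$ be an algebraically closed field of characteristic zero, $S=k[x_0,\dots,x_n]$, $\ell\ge 1$, and let $X_1,\dots,X_\ell\subset\mathbb P^n$ be closed subvarieties (more generally, closed subschemes) defined by homogeneous ideals $I_{X_1},\dots,I_{X_\ell}\subset S$ and forming a chain: for $i\ne j$, $X_i$ meets $X_j$ if and only if $|i-j|=1$. Let $X=\bigcup_i X_i$, with ideal $I_X=\bigcap_i I_{X_i}$. Suppose that there is a sequence $0=n_0<n_1<\cdots<n_\ell=n$ such that $$X_i\subset\{x_0=\cdots=x_{n_{i-1}-1}=0,\ x_{n_i+1}=\cdots=x_n=0\}\qquad(1\le i\le \ell),$$ i.e. $x_j\in I_{X_i}$ whenever $j<n_{i-1}$ or $j>n_i$. (If $X_i$ is a variety and $I_{X_i}$ is its full homogeneous ideal, this is the set-theoretic containment.) Put $S_i=k[x_{n_{i-1}},\dots,x_{n_i}]$ and $I_i=I_{X_i}\cap S_i$, and let $P$ and $P_i$ be the Hilbert polynomials of $S/I_X$ and of $S_i/I_i$. Let $m\ge1$ be an integer for which the $m$th Hilbert points of $X\subset\mathbb P^n$ and of all $X_i\subset\mathbb P^{n_i-n_{i-1}}$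 are defined, i.e. $\dim_k(S/I_X)_m=P(m)$ and $\dim_k(S_i/I_i)_m=P_i(m)$ for all $i$ (for instance, $m$ at least the Castelnuovo–Mumford regularity of all these ideals). For a homogeneous ideal $I$ of a polynomial ring $R=k[y_1,\dots,y_N]$ with $p=\dim_k(R/I)_m$, the dual $m$th Hilbert point is the one-dimensional quotient $\phi:\bigwedge^{p}R_m\to\bigwedge^{p}(R_m/I_m)$. Let $\rho$ be the diagonal one-parameter subgroup of $\mathrm{GL}_N$ with integer weights $(r_1,\dots,r_N)$, acting by $\rho(t)y_j=t^{r_j}y_j$, and let $\rho'=\rho^N\cdot\det(\rho)^{-1}$ be the associated one-parameter subgroup of $\mathrm{SL}_N$, with weights $Nr_j-\sum_i r_i$. The Hilbert–Mumford index of the dual Hilbert point with respect to $\rho$ is $$\mu=\frac1N\max\{-w:\ \phi\text{ is not zero on the subspace of }\textstyle\bigwedge^pR_m\text{ of }\rho'\text{-weight }w\}.$$ Denote this index by $\mu([X]_m^\star,\rho)$ for $I_X\subset S$ and by $\mu([X_i]_m^\star,\rho_i)$ for $I_i\subset S_i$. Let $\rho$ be the one-parameter subgroup of $\mathrm{GL}_{n+1}$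 diagonalized by $x_0,\dots,x_n$ with integer weights $(r_0,\dots,r_n)$, and let $\rho_i$ be its restriction to $\mathrm{GL}(kx_{n_{i-1}}+\cdots+kx_{n_i})$, with weights $(r_{n_{i-1}},\dots,r_{n_i})$. Then $$\mu([X]_m^\star,\rho)=\sum_{i=1}^{\ell}\mu([X_i]_m^\star,\rho_i)-\sum_{i=1}^{\ell}\left(\frac{mP_i(m)}{n_i-n_{i-1}+1}\sum_{j=n_{i-1}}^{n_i}r_j\right)+\frac{mP(m)}{n+1}\sum_{j=0}^n r_j+m\sum_{i=1}^{\ell-1}r_{n_i}.$$ -/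

import Mathlib

noncomputable section

namespace HilbertChain

open MvPolynomial

attribute [local instance] MvPolynomial.gradedAlgebra

/-- The points of the closed subscheme of the projective space with homogeneous coordinates
indexed by `σ` that is cut out by a homogeneous ideal. -/
def projZeroLocus {k : Type*} [Field k] {σ : Type*} (I : Ideal (MvPolynomial σ k)) :
    Set (Projectivization k (σ → k)) :=
  {p | ∀ f ∈ I, ∀ d : ℕ, f.IsHomogeneous d → eval p.rep f = 0}

/-- The homogeneous ideals `I 0, …, I (ℓ - 1)` define a chain: two distinct members meet if and
only if they are consecutive. -/
structure IsSubschemeChain {k : Type*} [Field k] {σ : Type*} {ℓ : ℕ}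
    (I : Fin ℓ → Ideal (MvPolynomial σ k)) : Prop where
  homogeneous : ∀ i, (I i).IsHomogeneous (homogeneousSubmodule σ k)
  meets_iff : ∀ i j, i ≠ j →
    ((projZeroLocus (I i) ∩ projZeroLocus (I j)).Nonempty ↔
      (i : ℕ) + 1 = j ∨ (j : ℕ) + 1 = i)

/-- The contraction `I ∩ k[x_j : j ∈ B]`, as an ideal of the polynomial ring `k[x_j : j ∈ B]`. -/
def contract {k : Type*} [Field k] {σ : Type*} (I : Ideal (MvPolynomial σ k)) (B : Set σ) :
    Ideal (MvPolynomial B k) :=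
  I.comap (rename (Subtype.val : B → σ) : MvPolynomial B k →ₐ[k] MvPolynomial σ k)

/-- The degree `m` piece `I_m`, as a subspace of `S_m`. -/
def gradedPiece {k : Type*} [Field k] {σ : Type*} (I : Ideal (MvPolynomial σ k)) (m : ℕ) :
    Submodule k (homogeneousSubmodule σ k m) :=
  (I.restrictScalars k).comap (homogeneousSubmodule σ k m).subtype

/-- The Hilbert function `m ↦ dim (S_m / I_m)`. -/
def hilbertFunction {k : Type*} [Field k] {σ : Type*} (I : Ideal (MvPolynomial σ k)) (m : ℕ) :
    ℕ :=
  Module.finrank k (homogeneousSubmodule σ k m ⧸ gradedPiece I m)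

/-- `P` is the Hilbert polynomial of `S / I`. -/
def IsHilbertPolynomial {k : Type*} [Field k] {σ : Type*} (I : Ideal (MvPolynomial σ k))
    (P : Polynomial ℚ) : Prop :=
  ∀ᶠ t : ℕ in Filter.atTop, P.eval (t : ℚ) = hilbertFunction I t

/-- The dual Hilbert point in Plücker form: the `p`-th exterior power, `p = dim (S_m / I_m)`, of
the quotient map `S_m → S_m / I_m`. Its target is a line, so this is a one-dimensional quotient
of `⋀^p S_m`, that is, a point of the projective space of such quotients. -/
def dualHilbertPoint {k : Type*} [Field k] {σ : Type*} (I : Ideal (MvPolynomial σ k)) (m : ℕ) :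
    ⋀[k]^(hilbertFunction I m) (homogeneousSubmodule σ k m) →ₗ[k]
      ⋀[k]^(hilbertFunction I m) (homogeneousSubmodule σ k m ⧸ gradedPiece I m) :=
  exteriorPower.map (hilbertFunction I m) (gradedPiece I m).mkQ

/-- The diagonal one-parameter subgroup with weights `r`: the substitution
`ρ(t) x_i = t ^ (r i) x_i`. -/
def onePS {k : Type*} [Field k] {σ : Type*} (r : σ → ℤ) (t : kˣ) :
    MvPolynomial σ k →ₐ[k] MvPolynomial σ k :=
  aeval fun i => C ((t ^ r i : kˣ) : k) * X i

theorem onePS_mem {k : Type*} [Field k] {σ : Type*} (r : σ → ℤ) (t : kˣ) (m : ℕ) :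
    ∀ f ∈ homogeneousSubmodule σ k m,
      (onePS r t).toLinearMap f ∈ homogeneousSubmodule σ k m := by
  intro f hf
  have h := IsHomogeneous.aeval (n := 1) ((mem_homogeneousSubmodule m f).1 hf)
    (fun i : σ => (C ((t ^ r i : kˣ) : k) * X i : MvPolynomial σ k))
    (fun i => by simpa using (isHomogeneous_C σ ((t ^ r i : kˣ) : k)).mul (isHomogeneous_X k i))
  rw [one_mul] at h
  exact h

/-- The action of `ρ(t)` on `S_m`. -/
def onePSDegree {k : Type*} [Field k] {σ : Type*} (r : σ → ℤ) (t : kˣ) (m : ℕ) :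
    homogeneousSubmodule σ k m →ₗ[k] homogeneousSubmodule σ k m :=
  (onePS r t).toLinearMap.restrict (onePS_mem r t m)

/-- The weight space of weight `w` for the action of `ρ` on `⋀^p S_m`. -/
def weightSpace (k : Type*) [Field k] {σ : Type*} (r : σ → ℤ) (m p : ℕ) (w : ℤ) :
    Set (⋀[k]^p (homogeneousSubmodule σ k m)) :=
  {ω | ∀ t : kˣ, exteriorPower.map p (onePSDegree r t m) ω = ((t ^ w : kˣ) : k) • ω}

/-- The state of the dual Hilbert point with respect to `ρ`: the weights `w` for which the weight
`w` component of the Hilbert point (its restriction to the weight space of weight `w`) is not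
zero. Here `ρ(t)` moves a functional `φ` on `⋀^p S_m` to `φ ∘ ρ(t)`. -/
def state {k : Type*} [Field k] {σ : Type*} (I : Ideal (MvPolynomial σ k)) (m : ℕ)
    (r : σ → ℤ) : Set ℤ :=
  {w | ∃ ω ∈ weightSpace k r m (hilbertFunction I m) w, dualHilbertPoint I m ω ≠ 0}

/-- Mumford's numerical function `max {-w : the weight w component is not zero}`. -/
def mumfordIndex {k : Type*} [Field k] {σ : Type*} (I : Ideal (MvPolynomial σ k)) (m : ℕ)
    (r : σ → ℤ) : ℤ :=
  sSup {a | -a ∈ state I m r}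

/-- The weights of `ρ ^ N · det(ρ)⁻¹`, where `N` is the number of coordinates: the
one-parameter subgroup of `SL_N` attached to the one-parameter subgroup `ρ` of `GL_N`. -/
def slWeights {σ : Type*} [Fintype σ] (r : σ → ℤ) : σ → ℤ :=
  fun i => (Fintype.card σ : ℤ) * r i - ∑ j, r j

/-- The Hilbert–Mumford index of the dual `m`-th Hilbert point with respect to the one-parameter
subgroup `ρ` of `GL_N` with weights `r`: the index for the attached one-parameter subgroup of
`SL_N`, divided by `N` (equivalently, the index for the rational weights `r_i - (∑ r_j) / N`). -/
def hmIndex {k : Type*} [Field k] {σ : Type*} [Fintype σ] (I : Ideal (MvPolynomial σ k)) (m : ℕ)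
    (r : σ → ℤ) : ℚ :=
  (mumfordIndex I m (slWeights r) : ℚ) / (Fintype.card σ : ℚ)

end HilbertChain

end

noncomputable section

namespace HilbertChain

open MvPolynomial

/-! Monomials diagonalize `ρ`, and the dual Hilbert point is nonzero on a wedge of monomials exactly
when they form a basis of `S_m / I_m`. So the state is the set of total weights of monomial bases
(`mem_state_iff`), and the index is `m · dim (S_m / I_m) / N · ∑ r_j` minus the least such weight
(`hmIndex_eq_of_isMinimal`). It remains to see that the least weight for `X` is the sum of those for
the `X_i`, minus `m ∑ r_{n_i}` over the junctions.

This is matroid gluing. A monomial contained in no block of variables lies in every `I_i`. Two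
blocks share a monomial of degree `m > 0` only if they are consecutive, and then only the power
`x_{n_i}^m`. As the two subschemes meet, they do so at the coordinate point of `x_{n_i}`, so this
power occurs in no degree `m` form of either ideal: it is a coloop, contained in every monomial
basis. Hence monomial bases for `X` are exactly unions of monomial bases for the blocks
(`OverlapsVanish.isMonomialBasis_biUnion`, `OverlapsVanish.isMonomialBasis_filter`), and adding
block weights counts each junction power twice. -/

theorem zpow_finset_sum {G α : Type*} [CommGroup G] (t : G) (s : Finset α) (f : α → ℤ) :
    t ^ (∑ i ∈ s, f i) = ∏ i ∈ s, t ^ f i := by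
  induction s using Finset.cons_induction with
  | empty => simp
  | cons a s ha ih => rw [Finset.sum_cons, Finset.prod_cons, zpow_add, ih]

/-! ### Independence modulo a subspace and nonvanishing of wedges. -/

section LinearAlgebra

variable {k V ι : Type*} [Field k] [AddCommGroup V] [Module k V]

theorem linearIndepOn_mkQ_basis_iff (b : Module.Basis ι k V) (K : Submodule k V) (s : Set ι) :
    LinearIndepOn k (fun i => K.mkQ (b i)) s ↔
      ∀ x ∈ K, ((b.repr x).support : Set ι) ⊆ s → x = 0 := by
  have key : ∀ l : ι →₀ k, Finsupp.linearCombination k (fun i => K.mkQ (b i)) l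
      = K.mkQ (b.repr.symm l) := by
    intro l
    rw [Module.Basis.repr_symm_apply, ← LinearMap.comp_apply, Finsupp.linearCombination_apply,
      LinearMap.comp_apply, Finsupp.linearCombination_apply, map_finsuppSum]
    simp
  rw [linearIndepOn_iff]
  constructor
  · intro h x hx hs
    have := h (b.repr x) hs (by rw [key]; simpa using hx)
    simpa using this
  · intro h l hl h0
    rw [key] at h0
    have := h (b.repr.symm l) (by simpa using h0)
      (by simpa only [LinearEquiv.apply_symm_apply] using (Finsupp.mem_supported k l).1 hl)
    exact (LinearEquiv.map_eq_zero_iff _).1 this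

/-- Trades the dimension count for maximality, so that later arguments handle only supports of
polynomials. -/
theorem card_eq_finrank_iff_maximal [Module.Finite k V] (v : ι → V)
    (hv : Submodule.span k (Set.range v) = ⊤) (s : Finset ι)
    (hs : LinearIndepOn k v (s : Set ι)) :
    s.card = Module.finrank k V ↔ ∀ i ∉ s, ¬ LinearIndepOn k v (insert i (s : Set ι)) := by
  classical
  constructor
  · intro hc i hi h
    have h2 : LinearIndepOn k v ((insert i s : Finset ι) : Set ι) := by simpa using h
    have := LinearIndependent.fintype_card_le_finrank (R := k) h2
    simp [Finset.card_insert_of_notMem hi] at this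
    omega
  · intro h
    have hspan : Submodule.span k (v '' s) = ⊤ := by
      rw [eq_top_iff, ← hv, Submodule.span_le]
      rintro _ ⟨i, rfl⟩
      by_cases hi : i ∈ s
      · exact Submodule.subset_span ⟨i, hi, rfl⟩
      · by_contra hn
        exact h i hi ((linearIndepOn_insert (by simpa using hi)).2 ⟨hs, hn⟩)
    have hB := Module.Basis.mk hs (by rw [← hspan, Set.image_eq_range])
    rw [Module.finrank_eq_card_basis hB]
    simp

theorem exteriorPower_map_ιMulti_family_diagonal [LinearOrder ι] (v : ι → V) (D : V →ₗ[k] V)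
    (c : ι → k) (hD : ∀ i, D (v i) = c i • v i) (p : ℕ) (s : Set.powersetCard ι p) :
    exteriorPower.map p D (exteriorPower.ιMulti_family k p v s)
      = (∏ i ∈ s.val, c i) • exteriorPower.ιMulti_family k p v s := by
  rw [exteriorPower.map_apply_ιMulti_family]
  unfold exteriorPower.ιMulti_family
  have : (D ∘ v) ∘ (Set.powersetCard.ofFinEmbEquiv.symm s)
      = fun j => c (Set.powersetCard.ofFinEmbEquiv.symm s j) •
        (v ∘ (Set.powersetCard.ofFinEmbEquiv.symm s)) j := by
    funext j
    simp [hD]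
  rw [this, AlternatingMap.map_smul_univ]
  congr 1
  refine (Finset.prod_map Finset.univ
    (Set.powersetCard.ofFinEmbEquiv.symm s).toEmbedding c).symm.trans ?_
  congr 1
  ext i
  have := Set.powersetCard.mem_range_ofFinEmbEquiv_symm_iff_mem s i
  rw [Set.mem_range, ← Set.powersetCard.mem_coe_iff] at this
  simpa using this

theorem ιMulti_family_ne_zero_iff [LinearOrder ι] (v : ι → V) (p : ℕ)
    (s : Set.powersetCard ι p) :
    exteriorPower.ιMulti_family k p v s ≠ 0 ↔ LinearIndepOn k v (s.val : Set ι) := by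
  set e := Set.powersetCard.ofFinEmbEquiv.symm s with he
  have hr : Set.range e = (s.val : Set ι) := by
    ext i
    simpa using Set.powersetCard.mem_range_ofFinEmbEquiv_symm_iff_mem s i
  have hiff : LinearIndepOn k v (s.val : Set ι) ↔ LinearIndependent k (v ∘ e) := by
    rw [← hr]
    exact linearIndepOn_range_iff e.injective v
  rw [hiff]
  constructor
  · intro h
    by_contra hn
    exact h (AlternatingMap.map_linearDependent _ _ hn)
  · intro h
    have h2 := exteriorPower.ιMulti_family_linearIndependent_field (n := p) h
    -- The identity embedding of `Fin p` indexes the full wedge of `v ∘ e`, a member of an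
    -- independent family.
    have h3 := h2.ne_zero (Set.powersetCard.ofFinEmbEquiv (RelEmbedding.refl _))
    simpa [exteriorPower.ιMulti_family, Function.comp_assoc] using h3

end LinearAlgebra

/-! ### The state in terms of monomial bases. -/

section Monomials

variable {k σ : Type*} [Field k]

/-- The monomials of degree `m`, as a basis of `S_m`. -/
def homogeneousBasis (k σ : Type*) [Field k] (m : ℕ) :
    Module.Basis {d : σ →₀ ℕ // d.degree = m} k (homogeneousSubmodule σ k m) :=
  Module.Basis.mk
    (v := fun d => ⟨monomial d.1 1, isHomogeneous_monomial 1 d.2⟩)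
    (LinearIndependent.of_comp (homogeneousSubmodule σ k m).subtype
      ((basisMonomials σ k).linearIndependent.comp _ Subtype.val_injective))
    (by
      rintro ⟨f, hf⟩ -
      have h : (⟨f, hf⟩ : homogeneousSubmodule σ k m) = ∑ d ∈ f.support.attach,
          coeff d.1 f • (⟨monomial d.1 1, isHomogeneous_monomial 1
            (hf.degree_eq_sum_deg_support d.2).symm⟩ : homogeneousSubmodule σ k m) := by
        apply Subtype.ext
        rw [AddSubmonoidClass.coe_finsetSum]
        simp only [Submodule.coe_smul, smul_monomial, smul_eq_mul, mul_one]
        rw [Finset.sum_attach f.support (fun d => monomial d (coeff d f))]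
        exact f.as_sum
      rw [h]
      exact Submodule.sum_mem _ fun d _ => Submodule.smul_mem _ _
        (Submodule.subset_span ⟨⟨d.1, (hf.degree_eq_sum_deg_support d.2).symm⟩, rfl⟩))

theorem coe_homogeneousBasis (m : ℕ) (d : {d : σ →₀ ℕ // d.degree = m}) :
    (homogeneousBasis k σ m d : MvPolynomial σ k) = monomial d.1 1 := by
  simp [homogeneousBasis]

theorem homogeneousBasis_repr (m : ℕ) (f : homogeneousSubmodule σ k m)
    (d : {d : σ →₀ ℕ // d.degree = m}) :
    (homogeneousBasis k σ m).repr f d = coeff d.1 (f : MvPolynomial σ k) := by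
  classical
  have h : (homogeneousBasis k σ m).coord d
      = (lcoeff k d.1).comp (homogeneousSubmodule σ k m).subtype := by
    refine (homogeneousBasis k σ m).ext fun e => ?_
    simp [coe_homogeneousBasis, Finsupp.single_apply, coeff_monomial, Subtype.ext_iff]
  exact LinearMap.congr_fun h f

theorem onePSDegree_homogeneousBasis (r : σ → ℤ) (t : kˣ) (m : ℕ)
    (d : {d : σ →₀ ℕ // d.degree = m}) :
    onePSDegree r t m (homogeneousBasis k σ m d)
      = ((t ^ Finsupp.weight r d.1 : kˣ) : k) • homogeneousBasis k σ m d := by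
  apply Subtype.ext
  rw [Submodule.coe_smul, coe_homogeneousBasis]
  change onePS r t (homogeneousBasis k σ m d : MvPolynomial σ k) = _
  rw [coe_homogeneousBasis, onePS, aeval_monomial, map_one, one_mul]
  simp only [mul_pow, Finsupp.prod_mul]
  rw [Finsupp.weight_apply, Finsupp.sum, smul_monomial, smul_eq_mul, mul_one,
    monomial_eq]
  congr 1
  rw [Finsupp.prod, zpow_finset_sum, Units.coe_prod, map_prod]
  refine Finset.prod_congr rfl fun i _ => ?_
  rw [← map_pow, ← Units.val_pow_eq_pow_val, nsmul_eq_mul, mul_comm, zpow_mul, zpow_natCast]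

/-- `B` is a basis of the matroid induced on the set `T` of monomials by linear independence
modulo `I`: it is maximal among the subsets of `T` that are independent modulo `I`. -/
structure IsMonomialBasis (I : Ideal (MvPolynomial σ k)) (T : Set (σ →₀ ℕ))
    (B : Finset (σ →₀ ℕ)) : Prop where
  subset : ∀ d ∈ B, d ∈ T
  indep : ∀ f ∈ I, (∀ d ∈ f.support, d ∈ B) → f = 0
  maximal : ∀ d ∈ T, d ∉ B → ∃ f ∈ I, f ≠ 0 ∧ ∀ e ∈ f.support, e = d ∨ e ∈ B

/-- Homogeneity of `f` need not be imposed: its support already lies in degree `m`. -/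
theorem linearIndepOn_homogeneousBasis_iff (I : Ideal (MvPolynomial σ k)) (m : ℕ)
    (s : Set {d : σ →₀ ℕ // d.degree = m}) :
    LinearIndepOn k (fun d => (gradedPiece I m).mkQ (homogeneousBasis k σ m d)) s ↔
      ∀ f ∈ I, (∀ d ∈ f.support, d ∈ Subtype.val '' s) → f = 0 := by
  rw [linearIndepOn_mkQ_basis_iff]
  constructor
  · intro h f hf hs
    have hhom : f ∈ homogeneousSubmodule σ k m := by
      intro d hd
      obtain ⟨e, -, rfl⟩ := hs d (mem_support_iff.2 hd)
      exact (DFunLike.congr_fun Finsupp.degree_eq_weight_one e.1).symm.trans e.2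
    have := h ⟨f, hhom⟩ hf (by
      intro d hd
      rw [Finset.mem_coe, Finsupp.mem_support_iff, homogeneousBasis_repr] at hd
      obtain ⟨e, he, hed⟩ := hs d.1 (mem_support_iff.2 hd)
      rwa [← Subtype.ext hed])
    exact congrArg Subtype.val this
  · intro h x hx hs
    refine Subtype.ext (h x.1 hx fun d hd => ?_)
    have hdm : d.degree = m := (x.2.degree_eq_sum_deg_support hd).symm
    refine ⟨⟨d, hdm⟩, hs ?_, rfl⟩
    rw [Finset.mem_coe, Finsupp.mem_support_iff, homogeneousBasis_repr]
    exact mem_support_iff.1 hd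

theorem finite_degree_eq [Finite σ] (m : ℕ) : Finite {d : σ →₀ ℕ // d.degree = m} :=
  (Finsupp.finite_of_degree_eq m).to_subtype

instance [Finite σ] (m : ℕ) : Module.Finite k (homogeneousSubmodule σ k m) :=
  have := finite_degree_eq (σ := σ) m
  Module.Finite.of_basis (homogeneousBasis k σ m)

theorem span_range_mkQ_homogeneousBasis (I : Ideal (MvPolynomial σ k)) (m : ℕ) :
    Submodule.span k (Set.range
      fun d => (gradedPiece I m).mkQ (homogeneousBasis k σ m d)) = ⊤ := by
  rw [Set.range_comp' (gradedPiece I m).mkQ, ← Submodule.map_span, Module.Basis.span_eq,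
    Submodule.map_top, Submodule.range_mkQ]

theorem isMonomialBasis_iff [Finite σ] (I : Ideal (MvPolynomial σ k)) (m : ℕ)
    (s : Finset {d : σ →₀ ℕ // d.degree = m}) :
    IsMonomialBasis I {d | d.degree = m} (s.map (Function.Embedding.subtype _)) ↔
      s.card = hilbertFunction I m ∧
      LinearIndepOn k (fun d => (gradedPiece I m).mkQ (homogeneousBasis k σ m d)) (s : Set _) := by
  have hspan := span_range_mkQ_homogeneousBasis I m
  rw [and_comm]
  constructor
  · intro h
    have hi : LinearIndepOn k (fun d => (gradedPiece I m).mkQ (homogeneousBasis k σ m d))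
        (s : Set _) := by
      rw [linearIndepOn_homogeneousBasis_iff]
      simpa using h.indep
    refine ⟨hi, (card_eq_finrank_iff_maximal _ hspan s hi).2 fun d hd hn => ?_⟩
    rw [linearIndepOn_homogeneousBasis_iff] at hn
    obtain ⟨f, hf, hf0, hs⟩ := h.maximal d.1 d.2 (by simpa [d.2] using hd)
    refine hf0 (hn f hf fun e he => ?_)
    rcases hs e he with rfl | h'
    · exact ⟨d, Or.inl rfl, rfl⟩
    · obtain ⟨e', he', rfl⟩ := Finset.mem_map.1 h'
      exact ⟨e', Or.inr he', rfl⟩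
  · rintro ⟨hi, hc⟩
    have hmax := (card_eq_finrank_iff_maximal _ hspan s hi).1 hc
    rw [linearIndepOn_homogeneousBasis_iff] at hi
    refine ⟨?_, by simpa using hi, fun d hd hdB => ?_⟩
    · intro d hd
      obtain ⟨e, -, rfl⟩ := Finset.mem_map.1 hd
      exact e.2
    · have := hmax ⟨d, hd⟩ (fun h => hdB (Finset.mem_map.2 ⟨_, h, rfl⟩))
      rw [linearIndepOn_homogeneousBasis_iff] at this
      push Not at this
      obtain ⟨f, hf, hs, hf0⟩ := this
      refine ⟨f, hf, hf0, fun e he => ?_⟩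
      obtain ⟨e', h | h, rfl⟩ := hs e he
      · exact Or.inl (congrArg Subtype.val h)
      · exact Or.inr (Finset.mem_map.2 ⟨_, h, rfl⟩)

/-- In characteristic zero `2` has infinite order, so `t = 2` alone separates the weights. -/
theorem eq_of_forall_zpow_eq [CharZero k] {a b : ℤ}
    (h : ∀ t : kˣ, ((t ^ a : kˣ) : k) = ((t ^ b : kˣ) : k)) : a = b := by
  have h2 := h (Units.mk0 2 two_ne_zero)
  simp only [Units.val_zpow_eq_zpow_val, Units.val_mk0] at h2
  have h3 : ((2 : ℚ) ^ a) = 2 ^ b := by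
    apply Rat.cast_injective (α := k)
    push_cast
    exact h2
  exact zpow_right_injective₀ (by norm_num) (by norm_num) h3

/-- Wedges of monomials form a weight basis of the exterior power. A weight vector not killed by the
Hilbert point has a nonzero coordinate at some wedge not killed by it, and comparing that coordinate
before and after `ρ(t)` identifies the weight. -/
theorem mem_state_iff [Finite σ] [CharZero k] (I : Ideal (MvPolynomial σ k)) (m : ℕ) (r : σ → ℤ)
    (w : ℤ) :
    w ∈ state I m r ↔ ∃ B, IsMonomialBasis I {d | d.degree = m} B ∧
      ∑ d ∈ B, Finsupp.weight r d = w := by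
  classical
  -- An arbitrary order, needed only to write wedges indexed by sets.
  let : LinearOrder {d : σ →₀ ℕ // d.degree = m} := linearOrderOfSTO WellOrderingRel
  set b := homogeneousBasis k σ m
  set p := hilbertFunction I m with hp
  have hdiag : ∀ (t : kˣ) (s : Set.powersetCard {d : σ →₀ ℕ // d.degree = m} p),
      exteriorPower.map p (onePSDegree r t m) (b.exteriorPower p s)
        = ((t ^ (∑ d ∈ s.val, Finsupp.weight r d.1) : kˣ) : k) • b.exteriorPower p s := by
    intro t s
    rw [exteriorPower.basis_apply, exteriorPower_map_ιMulti_family_diagonal b _ _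
      (onePSDegree_homogeneousBasis r t m)]
    congr 1
    rw [zpow_finset_sum, Units.coe_prod]
  have hne : ∀ s : Set.powersetCard {d : σ →₀ ℕ // d.degree = m} p,
      dualHilbertPoint I m (b.exteriorPower p s) ≠ 0 ↔
      IsMonomialBasis I {d | d.degree = m} (s.val.map (Function.Embedding.subtype _)) := by
    intro s
    rw [isMonomialBasis_iff, dualHilbertPoint, exteriorPower.basis_apply,
      exteriorPower.map_apply_ιMulti_family, ιMulti_family_ne_zero_iff]
    exact ⟨fun h => ⟨s.2, h⟩, fun h => h.2⟩
  constructor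
  · rintro ⟨ω, hω, h0⟩
    have hsum := (b.exteriorPower p).linearCombination_repr ω
    obtain ⟨s, hs, hs0⟩ : ∃ s, (b.exteriorPower p).repr ω s ≠ 0 ∧
        dualHilbertPoint I m (b.exteriorPower p s) ≠ 0 := by
      by_contra! hcon
      apply h0
      rw [← hsum, Finsupp.linearCombination_apply, map_finsuppSum]
      refine Finset.sum_eq_zero fun s hs => ?_
      beta_reduce
      rw [map_smul, hcon s (Finsupp.mem_support_iff.1 hs), smul_zero]
    refine ⟨_, (hne s).1 hs0, ?_⟩
    rw [Finset.sum_map]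
    refine eq_of_forall_zpow_eq (k := k) fun t => ?_
    have h1 : (b.exteriorPower p).coord s ∘ₗ exteriorPower.map p (onePSDegree r t m)
        = ((t ^ (∑ d ∈ s.val, Finsupp.weight r d.1) : kˣ) : k) • (b.exteriorPower p).coord s := by
      refine (b.exteriorPower p).ext fun s' => ?_
      rw [LinearMap.comp_apply, hdiag]
      by_cases hss : s' = s
      · subst hss; simp
      · simp only [map_smul, LinearMap.smul_apply, Module.Basis.coord_apply,
          Module.Basis.repr_self, Finsupp.single_eq_of_ne (Ne.symm hss), smul_zero]
    have h2 := LinearMap.congr_fun h1 ω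
    rw [LinearMap.comp_apply, hω t, map_smul, LinearMap.smul_apply, smul_eq_mul,
      smul_eq_mul] at h2
    exact (mul_right_cancel₀ hs h2).symm
  · rintro ⟨B, hB, rfl⟩
    obtain ⟨s, rfl⟩ : ∃ s : Finset {d : σ →₀ ℕ // d.degree = m},
        s.map (Function.Embedding.subtype _) = B :=
      ⟨B.subtype _, Finset.subtype_map_of_mem hB.subset⟩
    have hc := ((isMonomialBasis_iff I m s).1 hB).1
    refine ⟨b.exteriorPower p ⟨s, hc⟩, fun t => ?_, (hne ⟨s, hc⟩).2 hB⟩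
    rw [hdiag, Finset.sum_map]
    rfl

theorem weight_slWeights [Fintype σ] (r : σ → ℤ) (d : σ →₀ ℕ) :
    Finsupp.weight (slWeights r) d
      = Fintype.card σ * Finsupp.weight r d - d.degree * ∑ j, r j := by
  simp only [Finsupp.weight_apply, slWeights, Finsupp.degree_apply, Finsupp.sum, nsmul_eq_mul,
    mul_sub, Finset.sum_sub_distrib, Nat.cast_sum, Finset.sum_mul, Finset.mul_sum]
  congr 1
  · exact Finset.sum_congr rfl fun i _ => by ring
  · exact Finset.sum_comm

theorem IsMonomialBasis.card_eq [Finite σ] {I : Ideal (MvPolynomial σ k)} {m : ℕ}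
    {B : Finset (σ →₀ ℕ)} (hB : IsMonomialBasis I {d | d.degree = m} B) :
    B.card = hilbertFunction I m := by
  classical
  have h : (B.subtype (fun d => d.degree = m)).map (Function.Embedding.subtype _) = B :=
    Finset.subtype_map_of_mem hB.subset
  rw [← h] at hB
  rw [← ((isMonomialBasis_iff I m _).1 hB).1, ← Finset.card_map (Function.Embedding.subtype _), h]

/-- All monomial bases have the same cardinality and degree, so passing to `slWeights` scales their
weights by `N` and shifts them by one common constant; minimality is preserved. -/
theorem hmIndex_eq_of_isMinimal [Fintype σ] [Nonempty σ] [CharZero k]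
    {I : Ideal (MvPolynomial σ k)} {m : ℕ} {r : σ → ℤ} {B : Finset (σ →₀ ℕ)}
    (hB : IsMonomialBasis I {d | d.degree = m} B)
    (hmin : ∀ B', IsMonomialBasis I {d | d.degree = m} B' →
      ∑ d ∈ B, Finsupp.weight r d ≤ ∑ d ∈ B', Finsupp.weight r d) :
    hmIndex I m r = m * hilbertFunction I m / Fintype.card σ * ∑ j, (r j : ℚ)
      - ((∑ d ∈ B, Finsupp.weight r d : ℤ) : ℚ) := by
  have hN : 0 < Fintype.card σ := Fintype.card_pos
  have hw : ∀ B', IsMonomialBasis I {d | d.degree = m} B' →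
      ∑ d ∈ B', Finsupp.weight (slWeights r) d = Fintype.card σ * ∑ d ∈ B', Finsupp.weight r d
        - hilbertFunction I m * (m * ∑ j, r j) := by
    intro B' hB'
    rw [← hB'.card_eq, Finset.mul_sum, ← nsmul_eq_mul, ← Finset.sum_const,
      ← Finset.sum_sub_distrib]
    refine Finset.sum_congr rfl fun d hd => ?_
    rw [weight_slWeights, show d.degree = m from hB'.subset d hd]
  have hs : mumfordIndex I m (slWeights r)
      = hilbertFunction I m * (m * ∑ j, r j) - Fintype.card σ * ∑ d ∈ B, Finsupp.weight r d := by
    refine IsGreatest.csSup_eq ⟨?_, ?_⟩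
    · rw [Set.mem_ofPred_eq, mem_state_iff]
      exact ⟨B, hB, by rw [hw B hB]; ring⟩
    · intro a ha
      rw [Set.mem_ofPred_eq, mem_state_iff] at ha
      obtain ⟨B', hB', h⟩ := ha
      rw [hw B' hB'] at h
      have := mul_le_mul_of_nonneg_left (hmin B' hB') (Int.natCast_nonneg (Fintype.card σ))
      linarith
  have hN' : (Fintype.card σ : ℚ) ≠ 0 := by positivity
  rw [hmIndex, hs]
  push_cast
  field_simp

theorem exists_isMonomialBasis_minimal [Finite σ] (I : Ideal (MvPolynomial σ k)) (m : ℕ)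
    (r : σ → ℤ) :
    ∃ B, IsMonomialBasis I {d | d.degree = m} B ∧
      ∀ B', IsMonomialBasis I {d | d.degree = m} B' →
        ∑ d ∈ B, Finsupp.weight r d ≤ ∑ d ∈ B', Finsupp.weight r d := by
  classical
  have := finite_degree_eq (σ := σ) m
  have := Fintype.ofFinite {d : σ →₀ ℕ // d.degree = m}
  let v := fun d => (gradedPiece I m).mkQ (homogeneousBasis k σ m d)
  have hspan : Submodule.span k (Set.range v) = ⊤ := span_range_mkQ_homogeneousBasis I m
  -- An independent set of largest cardinality shows that monomial bases exist; the minimum is then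
  -- over a finite nonempty set.
  obtain ⟨s, hs, hmax⟩ := Finset.exists_max_image
    (Finset.univ.filter fun s : Finset {d : σ →₀ ℕ // d.degree = m} =>
      LinearIndepOn k v (s : Set _)) Finset.card ⟨∅, by simp⟩
  rw [Finset.mem_filter] at hs
  have hsB := (isMonomialBasis_iff I m s).2
    ⟨(card_eq_finrank_iff_maximal v hspan s hs.2).2 fun d hd hn => by
      have := hmax (insert d s) (by simpa using hn)
      rw [Finset.card_insert_of_notMem hd] at this
      omega, hs.2⟩
  obtain ⟨B, hB, hmin⟩ := Finset.exists_min_image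
    (Finset.univ.filter fun s : Finset {d : σ →₀ ℕ // d.degree = m} =>
      IsMonomialBasis I {d | d.degree = m} (s.map (Function.Embedding.subtype _)))
    (fun s => ∑ d ∈ s.map (Function.Embedding.subtype _), Finsupp.weight r d)
    ⟨s, by simpa using hsB⟩
  refine ⟨_, (Finset.mem_filter.1 hB).2, fun B' hB' => ?_⟩
  have h : (B'.subtype (fun d => d.degree = m)).map (Function.Embedding.subtype _) = B' :=
    Finset.subtype_map_of_mem hB'.subset
  rw [← h] at hB' ⊢
  exact hmin _ (Finset.mem_filter.2 ⟨Finset.mem_univ _, hB'⟩)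

end Monomials

/-! ### Contraction to a block of variables as restriction of the matroid. -/

section Contraction

variable {k σ : Type*} [Field k]

/-- The monomials of degree `m` in the variables indexed by `A`. -/
def monomialsIn (A : Set σ) (m : ℕ) : Set (σ →₀ ℕ) :=
  {d | d.degree = m ∧ ∀ j ∈ d.support, j ∈ A}

/-- Monomials in the variables indexed by `A`, as monomials in all variables. -/
def includeMonomial (A : Set σ) : (A →₀ ℕ) ↪ (σ →₀ ℕ) :=
  ⟨Finsupp.mapDomain Subtype.val, Finsupp.mapDomain_injective Subtype.val_injective⟩

theorem includeMonomial_mem {A : Set σ} {m : ℕ} {d : A →₀ ℕ} (hd : d.degree = m) :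
    includeMonomial A d ∈ monomialsIn A m := by
  classical
  constructor
  · rw [← hd]
    exact Finsupp.degree_mapDomain _ _
  · intro j hj
    have := Finsupp.mapDomain_support hj
    simp only [Finset.mem_image] at this
    obtain ⟨a, -, rfl⟩ := this
    exact a.2

theorem exists_includeMonomial_eq {A : Set σ} {m : ℕ} {d : σ →₀ ℕ} (hd : d ∈ monomialsIn A m) :
    ∃ e : A →₀ ℕ, e.degree = m ∧ includeMonomial A e = d := by
  have h : includeMonomial A (d.comapDomain Subtype.val Subtype.val_injective.injOn) = d :=
    Finsupp.mapDomain_comapDomain _ Subtype.val_injective _ fun j hj => by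
      simpa using hd.2 j hj
  refine ⟨_, ?_, h⟩
  conv_rhs => rw [← hd.1, ← h]
  exact (Finsupp.degree_mapDomain (Subtype.val : A → σ) _).symm

theorem weight_includeMonomial (A : Set σ) (r : σ → ℤ) (d : A →₀ ℕ) :
    Finsupp.weight r (includeMonomial A d) = Finsupp.weight (fun j : A => r j.val) d :=
  Finsupp.linearCombination_mapDomain ℕ _ _

theorem mem_support_rename_val {A : Set σ} {g : MvPolynomial A k} {d : σ →₀ ℕ} :
    d ∈ (rename (Subtype.val : A → σ) g).support ↔ ∃ e ∈ g.support, includeMonomial A e = d := by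
  classical
  rw [support_rename_of_injective Subtype.val_injective, Finset.mem_image]
  rfl

theorem exists_rename_val_eq {A : Set σ} (f : MvPolynomial σ k)
    (hf : ∀ d ∈ f.support, ∀ j ∈ d.support, j ∈ A) :
    ∃ g : MvPolynomial A k, rename (Subtype.val : A → σ) g = f := by
  refine exists_rename_eq_of_vars_subset_range f _ Subtype.val_injective fun j hj => ?_
  obtain ⟨d, hd, hjd⟩ := (mem_vars_iff_mem_support j).1 hj
  simpa using hf d hd j hjd

/-- A polynomial supported on monomials in `A` comes from the smaller ring, and lies in `I` exactly
when its preimage lies in the contraction. -/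
theorem isMonomialBasis_contract_iff (I : Ideal (MvPolynomial σ k)) (A : Set σ) (m : ℕ)
    (B : Finset (A →₀ ℕ)) :
    IsMonomialBasis (contract I A) {d | d.degree = m} B ↔
      IsMonomialBasis I (monomialsIn A m) (B.map (includeMonomial A)) := by
  have hinj := rename_injective (R := k) (Subtype.val : A → σ) Subtype.val_injective
  constructor
  · intro h
    have hsub : ∀ d ∈ B.map (includeMonomial A), d ∈ monomialsIn A m := by
      intro d hd
      obtain ⟨e, he, rfl⟩ := Finset.mem_map.1 hd
      exact includeMonomial_mem (h.subset e he)
    refine ⟨hsub, fun f hf hs => ?_, fun d hd hdB => ?_⟩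
    · obtain ⟨g, rfl⟩ := exists_rename_val_eq f fun d hd => (hsub d (hs d hd)).2
      rw [h.indep g hf fun e he => ?_, map_zero]
      simpa using hs _ (mem_support_rename_val.2 ⟨e, he, rfl⟩)
    · obtain ⟨e, he, rfl⟩ := exists_includeMonomial_eq hd
      obtain ⟨g, hg, hg0, hs⟩ := h.maximal e he (by simpa using hdB)
      refine ⟨rename Subtype.val g, hg, fun h0 => hg0 (hinj (by simpa using h0)), fun d hd => ?_⟩
      obtain ⟨e', he', rfl⟩ := mem_support_rename_val.1 hd
      simpa using hs e' he'
  · intro h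
    refine ⟨fun d hd => ?_, fun g hg hs => ?_, fun d hd hdB => ?_⟩
    · rw [← (h.subset _ (Finset.mem_map_of_mem _ hd)).1]
      exact (Finsupp.degree_mapDomain _ _).symm
    · refine hinj ((h.indep _ hg fun d hd => ?_).trans (map_zero _).symm)
      obtain ⟨e, he, rfl⟩ := mem_support_rename_val.1 hd
      exact Finset.mem_map_of_mem _ (hs e he)
    · obtain ⟨f, hf, hf0, hs⟩ := h.maximal _ (includeMonomial_mem hd) (by simpa using hdB)
      obtain ⟨g, rfl⟩ := exists_rename_val_eq (A := A) f fun e he => by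
        rcases hs e he with rfl | h'
        · exact (includeMonomial_mem hd).2
        · exact (h.subset e h').2
      refine ⟨g, hf, fun h0 => hf0 (by rw [h0, map_zero]), fun e he => ?_⟩
      simpa using hs _ (mem_support_rename_val.2 ⟨e, he, rfl⟩)

theorem exists_minimal_hmIndex_contract_eq [Finite σ] [CharZero k] (I : Ideal (MvPolynomial σ k))
    (A : Set σ) [Fintype A] [Nonempty A] (m : ℕ) (r : σ → ℤ) :
    ∃ B, IsMonomialBasis I (monomialsIn A m) B ∧
      (∀ B', IsMonomialBasis I (monomialsIn A m) B' →
        ∑ d ∈ B, Finsupp.weight r d ≤ ∑ d ∈ B', Finsupp.weight r d) ∧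
      hmIndex (contract I A) m (fun j => r j.val)
        = m * hilbertFunction (contract I A) m / Fintype.card A * ∑ j : A, (r j : ℚ)
          - ((∑ d ∈ B, Finsupp.weight r d : ℤ) : ℚ) := by
  obtain ⟨B, hB, hmin⟩ := exists_isMonomialBasis_minimal (contract I A) m (fun j => r j.val)
  have hsum : ∀ B : Finset (A →₀ ℕ), ∑ d ∈ B.map (includeMonomial A), Finsupp.weight r d
      = ∑ d ∈ B, Finsupp.weight (fun j : A => r j.val) d := by
    intro B
    simp [Finset.sum_map, weight_includeMonomial]
  refine ⟨B.map (includeMonomial A), (isMonomialBasis_contract_iff I A m B).1 hB,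
    fun B' hB' => ?_, ?_⟩
  · obtain ⟨B'', rfl⟩ : ∃ B'' : Finset (A →₀ ℕ), B''.map (includeMonomial A) = B' := by
      refine ⟨B'.preimage _ (includeMonomial A).injective.injOn, ?_⟩
      ext d
      simp only [Finset.mem_map, Finset.mem_preimage]
      constructor
      · rintro ⟨e, he, rfl⟩
        exact he
      · intro hd
        obtain ⟨e, -, rfl⟩ := exists_includeMonomial_eq (hB'.subset d hd)
        exact ⟨e, hd, rfl⟩
    rw [hsum, hsum]
    exact hmin _ ((isMonomialBasis_contract_iff I A m B'').2 hB')
  · rw [hsum]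
    exact hmIndex_eq_of_isMinimal hB hmin

end Contraction

/-! ### Gluing monomial bases along coloops. -/

section Gluing

variable {k σ : Type*} [Field k]

theorem monomial_mem_of_X_mem {I : Ideal (MvPolynomial σ k)} {d : σ →₀ ℕ} {j : σ}
    (hj : j ∈ d.support) (hX : X j ∈ I) (c : k) : monomial d c ∈ I := by
  refine I.mem_of_dvd ?_ hX
  rw [X_dvd_monomial]
  exact Or.inr (Finsupp.mem_support_iff.1 hj)

theorem mem_of_forall_monomial_mem {I : Ideal (MvPolynomial σ k)} {f : MvPolynomial σ k}
    (h : ∀ d ∈ f.support, ∀ c, monomial d c ∈ I) : f ∈ I := by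
  rw [f.as_sum]
  exact I.sum_mem fun d hd => h d hd _

/-- Truncation to a block stays in `I`, since each discarded term has a variable outside `A`. -/
theorem exists_mem_coeff_eq_ite {I : Ideal (MvPolynomial σ k)} {A : Set σ}
    (hX : ∀ j ∉ A, X j ∈ I) {f : MvPolynomial σ k} (hf : f ∈ I) :
    ∃ g ∈ I, (∀ d, (∀ j ∈ d.support, j ∈ A) → coeff d g = coeff d f) ∧
      ∀ d ∈ g.support, d ∈ f.support ∧ ∀ j ∈ d.support, j ∈ A := by
  classical
  set g := ∑ d ∈ f.support with ∀ j ∈ d.support, j ∈ A, monomial d (coeff d f) with hg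
  have hc : ∀ d, coeff d g = if ∀ j ∈ d.support, j ∈ A then coeff d f else 0 := by
    intro d
    rw [hg, coeff_sum]
    simp only [coeff_monomial, Finset.sum_ite_eq', Finset.mem_filter]
    by_cases h : ∀ j ∈ d.support, j ∈ A
    · by_cases h' : d ∈ f.support
      · rw [if_pos ⟨h', h⟩, if_pos h]
      · rw [if_neg (fun h'' => h' h''.1), if_pos h, notMem_support_iff.1 h']
    · rw [if_neg (fun h'' => h h''.2), if_neg h]
  refine ⟨g, ?_, fun d hd => by rw [hc, if_pos hd], fun d hd => ?_⟩
  · have : f - g ∈ I := by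
      refine mem_of_forall_monomial_mem fun d hd c => ?_
      rw [mem_support_iff, coeff_sub, hc] at hd
      by_cases h : ∀ j ∈ d.support, j ∈ A
      · rw [if_pos h, sub_self] at hd
        exact absurd rfl hd
      · push Not at h
        obtain ⟨j, hj, hjA⟩ := h
        exact monomial_mem_of_X_mem hj (hX j hjA) c
    simpa using I.sub_mem hf this
  · rw [mem_support_iff, hc] at hd
    by_cases h : ∀ j ∈ d.support, j ∈ A
    · rw [if_pos h] at hd
      exact ⟨mem_support_iff.2 hd, h⟩
    · rw [if_neg h] at hd
      exact absurd rfl hd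

variable {ι : Type*} {I : ι → Ideal (MvPolynomial σ k)} {A : ι → Set σ} {m : ℕ}

/-- In degree `m`, a monomial in the variables of two different blocks does not occur in the
elements of the ideals of these blocks. -/
def OverlapsVanish (I : ι → Ideal (MvPolynomial σ k)) (A : ι → Set σ) (m : ℕ) : Prop :=
  ∀ i j, i ≠ j → ∀ d ∈ monomialsIn (A i) m, d ∈ monomialsIn (A j) m →
    ∀ f ∈ I i, f.IsHomogeneous m → coeff d f = 0

theorem isHomogeneous_of_support {f : MvPolynomial σ k} (h : ∀ d ∈ f.support, d.degree = m) :
    f.IsHomogeneous m := fun d hd =>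
  (DFunLike.congr_fun Finsupp.degree_eq_weight_one d).symm.trans (h d (mem_support_iff.2 hd))

/-- For `j ≠ i`, no monomial of `f` lies in block `j`, so each has a variable belonging to `I j`. -/
theorem OverlapsVanish.mem_iInf (hO : OverlapsVanish I A m) (hX : ∀ i, ∀ j ∉ A i, X j ∈ I i)
    {i : ι} {f : MvPolynomial σ k} (hf : f ∈ I i) (hs : ∀ d ∈ f.support, d ∈ monomialsIn (A i) m) :
    f ∈ ⨅ i, I i := by
  rw [Ideal.mem_iInf]
  intro j
  by_cases hij : i = j
  · exact hij ▸ hf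
  refine mem_of_forall_monomial_mem fun d hd c => ?_
  have hd' : ¬ ∀ l ∈ d.support, l ∈ A j := fun h => mem_support_iff.1 hd
    (hO i j hij d (hs d hd) ⟨(hs d hd).1, h⟩ f hf (isHomogeneous_of_support fun e he => (hs e he).1))
  push Not at hd'
  obtain ⟨l, hl, hlA⟩ := hd'
  exact monomial_mem_of_X_mem hl (hX j l hlA) c

/-- Shared monomials are coloops: were `d` outside `B`, maximality would give a relation that cannot
involve `d`, against independence of `B`. -/
theorem OverlapsVanish.mem_basis (hO : OverlapsVanish I A m) {i j : ι} (hij : i ≠ j)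
    {B : Finset (σ →₀ ℕ)} (hB : IsMonomialBasis (I i) (monomialsIn (A i) m) B) {d : σ →₀ ℕ}
    (hi : d ∈ monomialsIn (A i) m) (hj : d ∈ monomialsIn (A j) m) : d ∈ B := by
  by_contra hd
  obtain ⟨f, hf, hf0, hs⟩ := hB.maximal d hi hd
  have hc : coeff d f = 0 := hO i j hij d hi hj f hf <| isHomogeneous_of_support fun e he => by
    rcases hs e he with rfl | h
    · exact hi.1
    · exact (hB.subset e h).1
  refine hf0 (hB.indep f hf fun e he => ?_)
  rcases hs e he with rfl | h
  · exact absurd hc (mem_support_iff.1 he)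
  · exact h

open Classical in
theorem OverlapsVanish.filter_biUnion [Fintype ι] (hO : OverlapsVanish I A m)
    {B : ι → Finset (σ →₀ ℕ)}
    (hB : ∀ i, IsMonomialBasis (I i) (monomialsIn (A i) m) (B i)) (i : ι) :
    (Finset.univ.biUnion B).filter (· ∈ monomialsIn (A i) m) = B i := by
  ext d
  simp only [Finset.mem_filter, Finset.mem_biUnion, Finset.mem_univ, true_and]
  constructor
  · rintro ⟨⟨j, hj⟩, hd⟩
    by_cases hij : i = j
    · exact hij ▸ hj
    · exact hO.mem_basis hij (hB i) hd ((hB j).subset d hj)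
  · exact fun hd => ⟨⟨i, hd⟩, (hB i).subset d hd⟩

open Classical in
-- Independence follows by truncating a relation to a block; for maximality, relations inside a
-- block lie in the intersection by `OverlapsVanish.mem_iInf`.
theorem OverlapsVanish.isMonomialBasis_biUnion [Fintype ι] (hO : OverlapsVanish I A m)
    (hX : ∀ i, ∀ j ∉ A i, X j ∈ I i) {B : ι → Finset (σ →₀ ℕ)}
    (hB : ∀ i, IsMonomialBasis (I i) (monomialsIn (A i) m) (B i)) :
    IsMonomialBasis (⨅ i, I i) {d | d.degree = m} (Finset.univ.biUnion B) := by
  have hmem : ∀ d, d ∈ Finset.univ.biUnion B ↔ ∃ i, d ∈ B i := by simp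
  refine ⟨fun d hd => ?_, fun f hf hs => ?_, fun d hd hdB => ?_⟩
  · obtain ⟨i, hi⟩ := (hmem d).1 hd
    exact ((hB i).subset d hi).1
  · by_contra hf0
    obtain ⟨d, hd⟩ := support_nonempty.2 hf0
    obtain ⟨i, hi⟩ := (hmem d).1 (hs d hd)
    obtain ⟨g, hg, hgc, hgs⟩ := exists_mem_coeff_eq_ite (hX i) (Ideal.mem_iInf.1 hf i)
    have hg0 : g = 0 := (hB i).indep g hg fun e he => by
      obtain ⟨he1, he2⟩ := hgs e he
      rw [← hO.filter_biUnion hB i, Finset.mem_filter]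
      obtain ⟨j, hj⟩ := (hmem e).1 (hs e he1)
      exact ⟨hs e he1, ((hB j).subset e hj).1, he2⟩
    have := hgc d ((hB i).subset d hi).2
    rw [hg0, coeff_zero] at this
    exact mem_support_iff.1 hd this.symm
  · by_cases h : ∃ i, ∀ j ∈ d.support, j ∈ A i
    · obtain ⟨i, hi⟩ := h
      obtain ⟨f, hf, hf0, hs⟩ := (hB i).maximal d ⟨hd, hi⟩
        (fun h => hdB ((hmem d).2 ⟨i, h⟩))
      refine ⟨f, hO.mem_iInf hX hf fun e he => ?_, hf0, fun e he => ?_⟩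
      · rcases hs e he with rfl | h
        · exact ⟨hd, hi⟩
        · exact (hB i).subset e h
      · exact (hs e he).imp_right fun h => (hmem e).2 ⟨i, h⟩
    -- A monomial in no block is itself an element of every ideal.
    · push Not at h
      refine ⟨monomial d 1, Ideal.mem_iInf.2 fun i => ?_, by simp, fun e he => ?_⟩
      · obtain ⟨j, hj, hjA⟩ := h i
        exact monomial_mem_of_X_mem hj (hX i j hjA) 1
      · exact Or.inl (by simpa using support_monomial_subset he)

theorem exists_mem_monomialsIn_of_isMonomialBasis (hX : ∀ i, ∀ j ∉ A i, X j ∈ I i)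
    {B : Finset (σ →₀ ℕ)} (hB : IsMonomialBasis (⨅ i, I i) {d | d.degree = m} B)
    {d : σ →₀ ℕ} (hd : d ∈ B) : ∃ i, d ∈ monomialsIn (A i) m := by
  by_contra! h
  have h0 := hB.indep (monomial d 1) (Ideal.mem_iInf.2 fun i => ?_) fun e he => ?_
  · simp at h0
  · have hi : ¬ ∀ j ∈ d.support, j ∈ A i := fun h' => h i ⟨hB.subset d hd, h'⟩
    push Not at hi
    obtain ⟨j, hj, hjA⟩ := hi
    exact monomial_mem_of_X_mem hj (hX i j hjA) 1
  · have : e = d := by simpa using support_monomial_subset he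
    rwa [this]

open Classical in
theorem OverlapsVanish.isMonomialBasis_filter (hO : OverlapsVanish I A m)
    (hX : ∀ i, ∀ j ∉ A i, X j ∈ I i) {B : Finset (σ →₀ ℕ)}
    (hB : IsMonomialBasis (⨅ i, I i) {d | d.degree = m} B) (i : ι) :
    IsMonomialBasis (I i) (monomialsIn (A i) m) (B.filter (· ∈ monomialsIn (A i) m)) := by
  refine ⟨fun d hd => (Finset.mem_filter.1 hd).2, fun f hf hs => ?_, fun d hd hdB => ?_⟩
  · exact hB.indep f (hO.mem_iInf hX hf fun d hd => (Finset.mem_filter.1 (hs d hd)).2)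
      fun d hd => (Finset.mem_filter.1 (hs d hd)).1
  · have hdB' : d ∉ B := fun h => hdB (Finset.mem_filter.2 ⟨h, hd⟩)
    obtain ⟨f, hf, hf0, hs⟩ := hB.maximal d hd.1 hdB'
    -- The relation must involve `d`, so its truncation to the block is nonzero.
    have hdf : d ∈ f.support := by
      by_contra hdf
      refine hf0 (hB.indep f hf fun e he => (hs e he).resolve_left ?_)
      rintro rfl
      exact hdf he
    obtain ⟨g, hg, hgc, hgs⟩ := exists_mem_coeff_eq_ite (hX i) (Ideal.mem_iInf.1 hf i)
    refine ⟨g, hg, ?_, fun e he => ?_⟩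
    · rintro rfl
      have := hgc d hd.2
      rw [coeff_zero] at this
      exact mem_support_iff.1 hdf this.symm
    · obtain ⟨he1, he2⟩ := hgs e he
      refine (hs e he1).imp_right fun h => Finset.mem_filter.2 ⟨h, hB.subset e h, he2⟩

end Gluing

/-! ### The geometry of the chain and the count of overlaps. -/

section Chain

variable {k : Type*} [Field k]

theorem eq_single_of_forall_mem_support {σ : Type*} {m : ℕ} {d : σ →₀ ℕ} {a : σ} (hd : d.degree = m)
    (h : ∀ l ∈ d.support, l = a) : d = Finsupp.single a m := by
  have hda' : d = Finsupp.single a (d a) := by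
    ext l
    by_cases hl : l = a
    · simp [hl]
    · rw [Finsupp.single_eq_of_ne hl]
      by_contra h'
      exact hl (h l (Finsupp.mem_support_iff.2 h'))
  rw [hda', Finsupp.degree_single] at hd
  rw [hda', hd]

/-- A common point has only its `a`-th coordinate nonzero, so evaluating `f` there leaves the
coefficient of `x_a^m` times a nonzero scalar. -/
theorem coeff_single_eq_zero_of_meets {σ : Type*} {I J : Ideal (MvPolynomial σ k)}
    (hne : (projZeroLocus I ∩ projZeroLocus J).Nonempty) {a : σ}
    (hX : ∀ l, l ≠ a → X l ∈ I ∨ X l ∈ J) {m : ℕ} {f : MvPolynomial σ k} (hf : f ∈ I)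
    (hfm : f.IsHomogeneous m) : coeff (Finsupp.single a m) f = 0 := by
  obtain ⟨p, hpI, hpJ⟩ := hne
  have h0 : ∀ l, l ≠ a → p.rep l = 0 := by
    intro l hl
    rcases hX l hl with h | h
    · simpa using hpI _ h 1 (isHomogeneous_X k l)
    · simpa using hpJ _ h 1 (isHomogeneous_X k l)
  have ha : p.rep a ≠ 0 := by
    intro h
    refine p.rep_nonzero (funext fun l => ?_)
    by_cases hl : l = a
    · rw [hl, h, Pi.zero_apply]
    · rw [h0 l hl, Pi.zero_apply]
  have he := hpI f hf m hfm
  rw [eval_eq, Finset.sum_eq_single (Finsupp.single a m)] at he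
  · rcases mul_eq_zero.1 he with h | h
    · exact h
    · obtain ⟨i, hi, h⟩ := Finset.prod_eq_zero_iff.1 h
      have hia : i = a := by simpa using Finsupp.support_single_subset hi
      exact absurd (eq_zero_of_pow_eq_zero (hia ▸ h)) ha
  · intro d hd hda
    obtain ⟨l, hl, hld⟩ : ∃ l, l ≠ a ∧ l ∈ d.support := by
      by_contra! h
      exact hda (eq_single_of_forall_mem_support (hfm.degree_eq_sum_deg_support hd).symm
        fun l hl => by_contra fun hla => h l hla hl)
    rw [Finset.prod_eq_zero hld, mul_zero]
    rw [h0 l hl, zero_pow (Finsupp.mem_support_iff.1 hld)]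
  · intro h
    rw [notMem_support_iff.1 h, zero_mul]

variable {n ℓ m : ℕ} {N : Fin (ℓ + 1) → Fin (n + 1)}

/-- The variables of `d` lie between `N j.castSucc` and `N i.succ`; as `m > 0` there is at least
one, which forces these endpoints to coincide. -/
theorem eq_single_of_mem_blocks (hN : StrictMono N) (hm : 0 < m) {i j : Fin ℓ} (hij : i < j)
    {d : Fin (n + 1) →₀ ℕ} (hi : d ∈ monomialsIn (Set.Icc (N i.castSucc) (N i.succ)) m)
    (hj : d ∈ monomialsIn (Set.Icc (N j.castSucc) (N j.succ)) m) :
    (i : ℕ) + 1 = j ∧ d = Finsupp.single (N j.castSucc) m := by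
  have hd0 : d ≠ 0 := by
    rintro rfl
    have := hi.1
    simp at this
    omega
  have hle : i.succ ≤ j.castSucc := by
    rw [Fin.le_def]; simpa using hij
  have hall : ∀ l ∈ d.support, N j.castSucc ≤ l ∧ l ≤ N i.succ := fun l hl =>
    ⟨(hj.2 l hl).1, (hi.2 l hl).2⟩
  obtain ⟨l, hl⟩ := Finsupp.support_nonempty_iff.2 hd0
  have hge : j.castSucc ≤ i.succ := hN.le_iff_le.1 ((hall l hl).1.trans (hall l hl).2)
  have heq : i.succ = j.castSucc := le_antisymm hle hge
  refine ⟨by simpa using congrArg Fin.val heq, eq_single_of_forall_mem_support hi.1 fun l hl => ?_⟩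
  exact le_antisymm (heq ▸ (hall l hl).2) (hall l hl).1

theorem overlapsVanish_of_chain {I : Fin ℓ → Ideal (MvPolynomial (Fin (n + 1)) k)}
    (hI : IsSubschemeChain I) (hN : StrictMono N)
    (hsub : ∀ (i : Fin ℓ) (j : Fin (n + 1)), j < N i.castSucc ∨ N i.succ < j → X j ∈ I i)
    (hm : 0 < m) :
    OverlapsVanish I (fun i => Set.Icc (N i.castSucc) (N i.succ)) m := by
  -- Away from the junction, every variable lies outside one of two consecutive blocks.
  have key : ∀ i j : Fin ℓ, (i : ℕ) + 1 = j → ∀ l, l ≠ N j.castSucc → X l ∈ I i ∨ X l ∈ I j := by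
    intro i j hij l hl
    have : i.succ = j.castSucc := Fin.ext (by simpa using hij)
    rcases lt_or_gt_of_ne hl with h | h
    · exact Or.inr (hsub j l (Or.inl h))
    · exact Or.inl (hsub i l (Or.inr (this ▸ h)))
  intro i j hij d hi hj f hf hfm
  rcases lt_or_gt_of_ne hij with h | h
  · obtain ⟨h1, rfl⟩ := eq_single_of_mem_blocks hN hm h hi hj
    exact coeff_single_eq_zero_of_meets ((hI.meets_iff i j hij).2 (Or.inl h1)) (key i j h1) hf hfm
  · obtain ⟨h1, rfl⟩ := eq_single_of_mem_blocks hN hm h hj hi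
    exact coeff_single_eq_zero_of_meets ((hI.meets_iff i j hij).2 (Or.inr h1))
      (fun l hl => (key j i h1 l hl).symm) hf hfm

theorem single_mem_monomialsIn {σ : Type*} {A : Set σ} {a : σ} (ha : a ∈ A) :
    Finsupp.single a m ∈ monomialsIn A m := by
  refine ⟨Finsupp.degree_single _ _, fun j hj => ?_⟩
  have : j = a := by simpa using Finsupp.support_single_subset hj
  rwa [this]

open Classical in
theorem sum_eq_sum_blocks_sub (hN : StrictMono N) (hm : 0 < m) (w : (Fin (n + 1) →₀ ℕ) → ℤ)
    {B : Finset (Fin (n + 1) →₀ ℕ)}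
    (hB : ∀ d ∈ B, ∃ i : Fin ℓ, d ∈ monomialsIn (Set.Icc (N i.castSucc) (N i.succ)) m)
    (hpure : ∀ i : Fin ℓ, (i : ℕ) ≠ 0 → Finsupp.single (N i.castSucc) m ∈ B) :
    ∑ d ∈ B, w d
      = ∑ i : Fin ℓ,
          ∑ d ∈ B.filter (· ∈ monomialsIn (Set.Icc (N i.castSucc) (N i.succ)) m), w d
        - ∑ i : Fin ℓ, if (i : ℕ) ≠ 0 then w (Finsupp.single (N i.castSucc) m) else 0 := by
  set T : Fin ℓ → Set (Fin (n + 1) →₀ ℕ) :=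
    fun i => monomialsIn (Set.Icc (N i.castSucc) (N i.succ)) m with hT
  have hmono : ∀ i : Fin ℓ, N i.castSucc ≤ N i.succ := fun i => hN.monotone (Fin.castSucc_le_succ i)
  -- Each junction power is assigned to the earlier block only, making the pieces a partition of
  -- `B`; the first block has no left junction, whence `i ≠ 0`.
  set C : Fin ℓ → Finset (Fin (n + 1) →₀ ℕ) := fun i =>
    B.filter fun d => d ∈ T i ∧ ¬ ((i : ℕ) ≠ 0 ∧ d = Finsupp.single (N i.castSucc) m) with hC
  have hdisj : ∀ i j : Fin ℓ, i < j → Disjoint (C i) (C j) := by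
    intro i j hij
    rw [Finset.disjoint_left]
    intro d hdi hdj
    simp only [hC, Finset.mem_filter] at hdi hdj
    refine hdj.2.2 ⟨?_, (eq_single_of_mem_blocks hN hm hij hdi.2.1 hdj.2.1).2⟩
    have := Fin.lt_def.1 hij
    omega
  have hunion : B = Finset.univ.biUnion C := by
    ext d
    simp only [Finset.mem_biUnion, Finset.mem_univ, true_and]
    constructor
    · intro hd
      -- The first block containing `d`: if `d` were its left junction power, the preceding block
      -- would contain `d` too.
      obtain ⟨i, hi, hmin⟩ := Finset.exists_min_image
        (Finset.univ.filter fun i => d ∈ T i) (fun i : Fin ℓ => (i : ℕ))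
        (by obtain ⟨i, hi⟩ := hB d hd; exact ⟨i, by simpa using hi⟩)
      have hdi : d ∈ T i := (Finset.mem_filter.1 hi).2
      refine ⟨i, Finset.mem_filter.2 ⟨hd, hdi, ?_⟩⟩
      rintro ⟨hi0, hdeq⟩
      let j : Fin ℓ := ⟨i - 1, by omega⟩
      have hj : j.succ = i.castSucc := Fin.ext (by simp [j]; omega)
      have hdj : d ∈ T j := by
        rw [hdeq, ← hj]
        exact single_mem_monomialsIn ⟨hmono j, le_rfl⟩
      have := hmin j (by simpa using hdj)
      simp only [j] at this
      omega
    · rintro ⟨i, hi⟩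
      exact (Finset.mem_filter.1 hi).1
  have hCsum : ∀ i : Fin ℓ, ∑ d ∈ C i, w d = ∑ d ∈ B.filter (· ∈ T i), w d
      - if (i : ℕ) ≠ 0 then w (Finsupp.single (N i.castSucc) m) else 0 := by
    intro i
    by_cases hi : (i : ℕ) ≠ 0
    · have hmem : Finsupp.single (N i.castSucc) m ∈ B.filter (· ∈ T i) :=
        Finset.mem_filter.2 ⟨hpure i hi, single_mem_monomialsIn ⟨le_rfl, hmono i⟩⟩
      have hCe : C i = (B.filter (· ∈ T i)).erase (Finsupp.single (N i.castSucc) m) := by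
        ext d
        simp only [hC, Finset.mem_filter, Finset.mem_erase]
        tauto
      rw [if_pos hi, hCe, ← Finset.sum_erase_add _ _ hmem, add_sub_cancel_right]
    · rw [if_neg hi, sub_zero]
      refine Finset.sum_congr ?_ fun _ _ => rfl
      ext d
      simp only [hC, Finset.mem_filter]
      tauto
  rw [← Finset.sum_sub_distrib]
  conv_lhs => rw [hunion]
  rw [Finset.sum_biUnion]
  · exact Finset.sum_congr rfl fun i _ => hCsum i
  · intro i _ j _ hij
    rcases lt_or_gt_of_ne hij with h | h
    · exact hdisj i j h
    · exact (hdisj j i h).symm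

theorem sum_castSucc_ite_ne_zero (c : Fin (ℓ + 1) → ℤ) :
    (∑ i : Fin ℓ, if (i : ℕ) ≠ 0 then c i.castSucc else 0)
      = ∑ i ∈ Finset.Ioo 0 (Fin.last ℓ), c i := by
  have h : Finset.Ioo 0 (Fin.last ℓ)
      = (Finset.univ.filter fun i : Fin ℓ => (i : ℕ) ≠ 0).map Fin.castSuccEmb := by
    ext i
    simp only [Finset.mem_Ioo, Finset.mem_map, Finset.mem_filter, Finset.mem_univ, true_and]
    constructor
    · rintro ⟨h0, hl⟩
      refine ⟨i.castLT (Fin.lt_def.1 hl), ?_, rfl⟩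
      have := Fin.lt_def.1 h0
      simp at this ⊢
      omega
    · rintro ⟨j, hj, rfl⟩
      refine ⟨?_, Fin.castSucc_lt_last j⟩
      rw [Fin.lt_def]
      simp
      omega
  rw [h, Finset.sum_map, Finset.sum_filter]
  rfl

end Chain

end HilbertChain

end

/-! ### Blockwise minimization and the final formula. -/

theorem proposition1p5 {k : Type*} [Field k] [IsAlgClosed k] [CharZero k]
    {n ℓ : ℕ} (hℓ : 1 ≤ ℓ)
    (I : Fin ℓ → Ideal (MvPolynomial (Fin (n + 1)) k))
    (hI : HilbertChain.IsSubschemeChain I)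
    (N : Fin (ℓ + 1) → Fin (n + 1)) (hN : StrictMono N)
    (hN0 : N 0 = 0) (hNl : N (Fin.last ℓ) = Fin.last n)
    (hsub : ∀ (i : Fin ℓ) (j : Fin (n + 1)),
      j < N i.castSucc ∨ N i.succ < j → MvPolynomial.X j ∈ I i)
    (P : Polynomial ℚ) (hP : HilbertChain.IsHilbertPolynomial (⨅ i, I i) P)
    (Q : Fin ℓ → Polynomial ℚ)
    (hQ : ∀ i, HilbertChain.IsHilbertPolynomial
      (HilbertChain.contract (I i) (Set.Icc (N i.castSucc) (N i.succ))) (Q i))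
    (m : ℕ) (hm : 0 < m)
    (hPm : (HilbertChain.hilbertFunction (⨅ i, I i) m : ℚ) = P.eval (m : ℚ))
    (hQm : ∀ i, (HilbertChain.hilbertFunction
      (HilbertChain.contract (I i) (Set.Icc (N i.castSucc) (N i.succ))) m : ℚ)
        = (Q i).eval (m : ℚ))
    (r : Fin (n + 1) → ℤ) :
    HilbertChain.hmIndex (⨅ i, I i) m r
      = ∑ i : Fin ℓ, HilbertChain.hmIndex
          (HilbertChain.contract (I i) (Set.Icc (N i.castSucc) (N i.succ))) m
          (fun j => r j.val)
        - ∑ i : Fin ℓ, (m * (Q i).eval (m : ℚ)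
            / (((N i.succ : ℕ) : ℚ) - ((N i.castSucc : ℕ) : ℚ) + 1)
            * ∑ j ∈ Finset.Icc (N i.castSucc) (N i.succ), (r j : ℚ))
        + m * P.eval (m : ℚ) / ((n : ℚ) + 1) * ∑ j, (r j : ℚ)
        + m * ∑ i ∈ Finset.Ioo 0 (Fin.last ℓ), (r (N i) : ℚ) := by
  classical
  have hmono : ∀ i : Fin ℓ, N i.castSucc ≤ N i.succ := fun i => hN.monotone (Fin.castSucc_le_succ i)
  have hX : ∀ i : Fin ℓ, ∀ j ∉ Set.Icc (N i.castSucc) (N i.succ), MvPolynomial.X j ∈ I i := by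
    intro i j hj
    refine hsub i j ?_
    by_contra! h
    exact hj h
  have hO := HilbertChain.overlapsVanish_of_chain hI hN hsub hm
  have hne : ∀ i : Fin ℓ, Nonempty (Set.Icc (N i.castSucc) (N i.succ)) :=
    fun i => ⟨⟨_, le_rfl, hmono i⟩⟩
  choose B hB hmin hidx using fun i : Fin ℓ =>
    HilbertChain.exists_minimal_hmIndex_contract_eq (I i)
      (Set.Icc (N i.castSucc) (N i.succ)) m r
  have hpure : ∀ B' : Finset (Fin (n + 1) →₀ ℕ), (∀ i, HilbertChain.IsMonomialBasis (I i)
      (HilbertChain.monomialsIn (Set.Icc (N i.castSucc) (N i.succ)) m)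
      (B'.filter (· ∈ HilbertChain.monomialsIn (Set.Icc (N i.castSucc) (N i.succ)) m))) →
      ∀ i : Fin ℓ, (i : ℕ) ≠ 0 → Finsupp.single (N i.castSucc) m ∈ B' := by
    intro B' hB' i hi
    let j : Fin ℓ := ⟨i - 1, by omega⟩
    have hj : j.succ = i.castSucc := Fin.ext (by simp [j]; omega)
    have hij : i ≠ j := fun h => by
      have := congrArg Fin.val h
      simp only [j] at this
      omega
    exact (Finset.mem_filter.1 (hO.mem_basis hij (hB' i)
      (HilbertChain.single_mem_monomialsIn ⟨le_rfl, hmono i⟩)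
      (HilbertChain.single_mem_monomialsIn (hj ▸ ⟨hmono j, le_rfl⟩)))).1
  -- The correction term does not depend on `B'`, so the weight can be minimized block by block.
  have hsum : ∀ B', HilbertChain.IsMonomialBasis (⨅ i, I i) {d | d.degree = m} B' →
      ∑ d ∈ B', Finsupp.weight r d = ∑ i : Fin ℓ, ∑ d ∈ B'.filter
        (· ∈ HilbertChain.monomialsIn (Set.Icc (N i.castSucc) (N i.succ)) m), Finsupp.weight r d
        - m * ∑ i ∈ Finset.Ioo 0 (Fin.last ℓ), r (N i) := by
    intro B' hB'
    rw [HilbertChain.sum_eq_sum_blocks_sub hN hm _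
      (fun d hd => HilbertChain.exists_mem_monomialsIn_of_isMonomialBasis hX hB' hd)
      (hpure B' (hO.isMonomialBasis_filter hX hB')), Finset.mul_sum,
      ← HilbertChain.sum_castSucc_ite_ne_zero]
    simp [Finsupp.weight_apply]
  have hU := hO.isMonomialBasis_biUnion hX hB
  have hsumU := hsum _ hU
  simp only [hO.filter_biUnion hB] at hsumU
  -- The union of blockwise minimal bases is minimal, because every competitor restricts to a basis
  -- in each block.
  have hX' := HilbertChain.hmIndex_eq_of_isMinimal (r := r) hU fun B' hB' => by
    rw [hsumU, hsum B' hB']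
    exact sub_le_sub_right (Finset.sum_le_sum fun i _ =>
      hmin i _ (hO.isMonomialBasis_filter hX hB' i)) _
  have hcard : ∀ i : Fin ℓ, (Fintype.card (Set.Icc (N i.castSucc) (N i.succ)) : ℚ)
      = ((N i.succ : ℕ) : ℚ) - ((N i.castSucc : ℕ) : ℚ) + 1 := by
    intro i
    have h := Fin.le_def.1 (hmono i)
    rw [Fintype.card_ofFinset, Fin.card_Icc, Nat.cast_sub (by omega)]
    push_cast
    ring
  have hsr : ∀ i : Fin ℓ, ∑ j : Set.Icc (N i.castSucc) (N i.succ), (r j : ℚ)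
      = ∑ j ∈ Finset.Icc (N i.castSucc) (N i.succ), (r j : ℚ) := fun i =>
    (Finset.sum_subtype _ (fun x => by simp) (fun j => (r j : ℚ))).symm
  rw [hX', hsumU, hPm, Fintype.card_fin]
  simp only [hidx, hQm, hcard, hsr, Finset.sum_sub_distrib]
  push_cast
  ring
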